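/- **Proposition (Semiconcavity of the generalized distance).** Let $d\in\mathbb N$ and let $p\ge 1$ be real. Let $\mathscr P_p(\mathbb R^d)$ be the set of Borel probability measures $\mu$ on $\mathbb R^d$ with $\int|x|^p\,d\mu<\infty$ (where $|\cdot|$ is the Euclidean norm), and let $W_p(\mu,\nu)=\bigl(\inf_\pi\int|x-y|^p\,d\pi(x,y)\bigr)^{1/p}$ be the $p$-Wasserstein distance, the infimum being over all Borel probability measures $\pi$ on $\mathbb R^d\times\mathbb R^d$ with marginals $\mu$ and $\nu$. For a set $\Phi$ of bounded continuous functions $\mathbb R^d\to\mathbb R$ put $$\tilde S_p^\Phi=\Bigl\{\mu\in\mathscr P_p(\mathbb R^d):\ \int\varphi\,d\mu\le 0\ \text{ for all }\varphi\in\Phi\Bigr\},\qquad \tilde d_{\tilde S_p^\Phi}(\mu)=\inf_{\nu\in\tilde S_p^\Phi}W_p(\mu,\nu).$$ Suppose that $\tilde S_p^\Phi$ is nonempty and admits a classical counterpart $S\subseteq\mathbb R^d$, that is, $\tilde S_p^\Phi=\{\mu\in\mathscr P_p(\mathbb R^d):\ \operatorname{supp}\mu\subseteq S\}$. Let $K\subseteq\mathbb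 R^d\setminus S$ be compact and convex. Then there is a constant $C>0$, depending only on $d$, $p$, $K$ and $S$, such that for all $\mu_0,\mu_1\in\mathscr P_p(\mathbb R^d)$ with supports contained in $K$, for every constant speed geodesic $(\mu_t)_{t\in[0,1]}\subseteq\mathscr P_p(\mathbb R^d)$ joining $\mu_0$ and $\mu_1$ (i.e. $W_p(\mu_s,\mu_t)=(t-s)W_p(\mu_0,\mu_1)$ for all $0\le s\le t\le 1$) and every $t\in[0,1]$, $$\tilde d_{\tilde S_p^\Phi}(\mu_t)^p\ \ge\ (1-t)\,\tilde d_{\tilde S_p^\Phi}(\mu_0)^p+t\,\tilde d_{\tilde S_p^\Phi}(\mu_1)^p-C\,t(1-t)\,W_p(\mu_0,\mu_1)^{\min\{p,2\}}.$$ -/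

import Mathlib

open MeasureTheory Set
open scoped ENNReal BoundedContinuousFunction

namespace GenTarget

/-- The Euclidean space of dimension `d`. -/
abbrev E (d : ℕ) : Type := EuclideanSpace ℝ (Fin d)

/-- Borel probability measures on the Euclidean space with finite `p`-th moment. -/
def probP (d : ℕ) (p : ℝ) : Set (ProbabilityMeasure (E d)) :=
  {μ | ∫⁻ x, ‖x‖ₑ ^ p ∂(μ : Measure (E d)) < ∞}

/-- Elements of `probP d p` whose support is contained in `K`. -/
def probPOn {d : ℕ} (p : ℝ) (K : Set (E d)) : Set (ProbabilityMeasure (E d)) :=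
  {μ | μ ∈ probP d p ∧ (μ : Measure (E d)).support ⊆ K}

/-- Admissible transport plans: probability measures on the product with marginals `μ`, `ν`. -/
def plans {d : ℕ} (μ ν : ProbabilityMeasure (E d)) : Set (ProbabilityMeasure (E d × E d)) :=
  {π | (π : Measure (E d × E d)).map Prod.fst = (μ : Measure (E d)) ∧
       (π : Measure (E d × E d)).map Prod.snd = (ν : Measure (E d))}

/-- The optimal transport cost for the cost function `|x - y| ^ p`, with values in `[0, ∞]`. -/
noncomputable def cost {d : ℕ} (p : ℝ) (μ ν : ProbabilityMeasure (E d)) : ℝ≥0∞ :=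
  ⨅ π ∈ plans μ ν, ∫⁻ z, ‖z.1 - z.2‖ₑ ^ p ∂(π : Measure (E d × E d))

/-- The `p`-Wasserstein distance. The cost is finite on `probP d p`, see `cost_lt_top`. -/
noncomputable def W {d : ℕ} (p : ℝ) (μ ν : ProbabilityMeasure (E d)) : ℝ :=
  (cost p μ ν).toReal ^ (1 / p)

theorem cost_lt_top {d : ℕ} {p : ℝ} (hp : 1 ≤ p) {μ ν : ProbabilityMeasure (E d)}
    (hμ : μ ∈ probP d p) (hν : ν ∈ probP d p) : cost p μ ν < ∞ := by
  have hmem : μ.prod ν ∈ plans μ ν := by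
    refine ⟨?_, ?_⟩ <;> simp [ProbabilityMeasure.toMeasure_prod]
  refine (iInf₂_le _ hmem).trans_lt ?_
  have hpt : ∀ z : E d × E d,
      ‖z.1 - z.2‖ₑ ^ p ≤ (2 : ℝ≥0∞) ^ (p - 1) * (‖z.1‖ₑ ^ p + ‖z.2‖ₑ ^ p) := fun z =>
    (ENNReal.rpow_le_rpow enorm_sub_le (by linarith)).trans
      (ENNReal.rpow_add_le_mul_rpow_add_rpow _ _ hp)
  refine (lintegral_mono hpt).trans_lt ?_
  rw [lintegral_const_mul _ (by fun_prop), lintegral_add_left (by fun_prop)]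
  refine ENNReal.mul_lt_top (ENNReal.rpow_lt_top_of_nonneg (by linarith) (by simp))
    (ENNReal.add_lt_top.2 ⟨?_, ?_⟩)
  · have h := hmem.1
    have := lintegral_map (μ := ((μ.prod ν : ProbabilityMeasure (E d × E d)) :
      Measure (E d × E d))) (f := fun x : E d => ‖x‖ₑ ^ p) (by fun_prop) measurable_fst
    rw [h] at this
    rw [← this]
    exact hμ
  · have h := hmem.2
    have := lintegral_map (μ := ((μ.prod ν : ProbabilityMeasure (E d × E d)) :
      Measure (E d × E d))) (f := fun x : E d => ‖x‖ₑ ^ p) (by fun_prop) measurable_snd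
    rw [h] at this
    rw [← this]
    exact hν

/-- The set of probability measures `μ` with `∫ φ dμ ≤ 0` for every `φ ∈ Φ`. -/
def target {d : ℕ} (Φ : Set (E d →ᵇ ℝ)) : Set (ProbabilityMeasure (E d)) :=
  {μ | ∀ φ ∈ Φ, ∫ x, φ x ∂(μ : Measure (E d)) ≤ 0}

/-- The measures of the generalized target generated by `Φ` that have finite `p`-th moment. -/
def targetP {d : ℕ} (p : ℝ) (Φ : Set (E d →ᵇ ℝ)) : Set (ProbabilityMeasure (E d)) :=
  target Φ ∩ probP d p

/-- The generalized distance from `T`: the infimum of `W p μ ν` over `ν ∈ T`. -/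
noncomputable def genDist {d : ℕ} (p : ℝ) (T : Set (ProbabilityMeasure (E d)))
    (μ : ProbabilityMeasure (E d)) : ℝ :=
  sInf (W p μ '' T)

/-- `S` is a classical counterpart of `T ⊆ probP d p`: the elements of `T` are exactly the
measures with finite `p`-th moment and support contained in `S`. -/
def IsClassicalCounterpart {d : ℕ} (p : ℝ) (T : Set (ProbabilityMeasure (E d)))
    (S : Set (E d)) : Prop :=
  T = {μ : ProbabilityMeasure (E d) | (μ : Measure (E d)).support ⊆ S} ∩ probP d p

/-- Constant speed geodesics for `W p`, parametrized by `[0, 1]`; values of `μ` outside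
`[0, 1]` are irrelevant. -/
structure IsGeodesic {d : ℕ} (p : ℝ) (μ : ℝ → ProbabilityMeasure (E d)) : Prop where
  mem : ∀ t ∈ Icc (0 : ℝ) 1, μ t ∈ probP d p
  speed : ∀ s t : ℝ, 0 ≤ s → s ≤ t → t ≤ 1 → W p (μ s) (μ t) = (t - s) * W p (μ 0) (μ 1)

end GenTarget

/-! For a closed nonempty `S`, the cheapest way to reach measures carried by `S` is to send each
point to an almost nearest point of `S`. Hence the `p`-th power of the generalized distance is the
integral of `Metric.infDist x S ^ p` (`genDist_rpow`), and `Φ` matters only through `S`. Dirac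
masses show that a classical counterpart is closed (`IsClassicalCounterpart.isClosed`).

For `p > 1` the integrand is semiconcave on `K` (`exists_combo_infDist_rpow_le`): at an intermediate
point replace `S` by a nearest point, which reduces the claim to semiconcavity of `‖·‖ ^ p` on
bounded sets. Geodesics are displacement interpolations because `‖·‖ ^ p` is strictly convex. An
approximate form suffices: almost optimal plans from `μ` to `ρ` and from `ρ` to `ν` are glued, and
quantitative strict convexity puts the middle point close in `L^p` to the interpolation of the end
points (`exists_near_interpolation`). Integrating the pointwise inequality and letting the error
tend to zero gives the claim.

For `p = 1` geodesics need not interpolate along segments, but the distance from `S` is 1-Lipschitz,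
and this alone gives the inequality with constant 2. -/

namespace GenTarget

/-! ### Strict convexity of `‖·‖ ^ p` -/

theorem norm_combo_rpow_lt {V : Type*} [NormedAddCommGroup V] [NormedSpace ℝ V]
    [StrictConvexSpace ℝ V] {p t : ℝ} (hp : 1 < p) (ht0 : 0 < t) (ht1 : t < 1) {u v : V}
    (huv : u ≠ v) :
    ‖t • u + (1 - t) • v‖ ^ p < t * ‖u‖ ^ p + (1 - t) * ‖v‖ ^ p := by
  have hs : 0 < 1 - t := by linarith
  -- Strictness comes from the strictly convex space when the norms agree, and from `r ↦ r ^ p` when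
  -- they differ.
  by_cases h : ‖u‖ = ‖v‖
  · have h1 := norm_combo_lt_of_ne (r := ‖v‖) h.le le_rfl huv ht0 hs (by ring)
    have h2 := Real.rpow_lt_rpow (norm_nonneg _) h1 (by linarith : 0 < p)
    rw [h]
    linarith
  · have h1 : ‖t • u + (1 - t) • v‖ ≤ t * ‖u‖ + (1 - t) * ‖v‖ := by
      refine (norm_add_le _ _).trans_eq ?_
      rw [norm_smul, norm_smul, Real.norm_of_nonneg ht0.le, Real.norm_of_nonneg hs.le]
    refine (Real.rpow_le_rpow (norm_nonneg _) h1 (by linarith)).trans_lt ?_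
    simpa using (strictConvexOn_rpow hp).2 (norm_nonneg u) (norm_nonneg v) h ht0 hs (by ring)

theorem norm_combo_rpow_le {V : Type*} [NormedAddCommGroup V] [NormedSpace ℝ V]
    [StrictConvexSpace ℝ V] {p t : ℝ} (hp : 1 < p) (ht0 : 0 < t) (ht1 : t < 1) (u v : V) :
    ‖t • u + (1 - t) • v‖ ^ p ≤ t * ‖u‖ ^ p + (1 - t) * ‖v‖ ^ p := by
  by_cases huv : u = v
  · subst huv
    rw [← add_smul, add_sub_cancel, one_smul]
    linarith
  · exact (norm_combo_rpow_lt hp ht0 ht1 huv).le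

/-- A quantitative form of the strict convexity of `‖·‖ ^ p`. -/
theorem exists_norm_sub_rpow_le {V : Type*} [NormedAddCommGroup V] [NormedSpace ℝ V]
    [StrictConvexSpace ℝ V] [ProperSpace V] {p t : ℝ} (hp : 1 < p) (ht0 : 0 < t) (ht1 : t < 1)
    {ε : ℝ} (hε : 0 < ε) :
    ∃ C : ℝ, 0 ≤ C ∧ ∀ u v : V, ‖u - v‖ ^ p ≤ ε * (‖u‖ ^ p + ‖v‖ ^ p) +
      C * (t * ‖u‖ ^ p + (1 - t) * ‖v‖ ^ p - ‖t • u + (1 - t) • v‖ ^ p) := by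
  have hp0 : 0 < p := by linarith
  set F : V × V → ℝ := fun z =>
    t * ‖z.1‖ ^ p + (1 - t) * ‖z.2‖ ^ p - ‖t • z.1 + (1 - t) • z.2‖ ^ p with hF
  have hc : ∀ f : V × V → V, Continuous f → Continuous fun z => ‖f z‖ ^ p := fun f hf =>
    hf.norm.rpow_const fun _ => Or.inr hp0.le
  have hFc : Continuous F := by
    have h1 := hc _ continuous_fst
    have h2 := hc _ continuous_snd
    have h3 := hc (fun z => t • z.1 + (1 - t) • z.2) (by fun_prop)
    exact ((continuous_const.mul h1).add (continuous_const.mul h2)).sub h3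
  have hF0 : ∀ z, 0 ≤ F z := fun z => sub_nonneg.2 (norm_combo_rpow_le hp ht0 ht1 z.1 z.2)
  -- `A` is the part of the unit sphere where the `ε` term alone does not give a strict inequality.
  -- There `u ≠ v`, so the convexity defect `F` is positive, and by compactness it is at least some
  -- `c > 0`; since `‖u - v‖ ≤ 2` on the sphere, `2 ^ p / c` serves as constant.
  set A : Set (V × V) := Metric.sphere 0 1 ∩
    {z | ε * (‖z.1‖ ^ p + ‖z.2‖ ^ p) ≤ ‖z.1 - z.2‖ ^ p} with hA
  have hAc : IsCompact A := by
    refine (isCompact_sphere _ _).inter_right (isClosed_le ?_ (hc _ (by fun_prop)))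
    exact continuous_const.mul ((hc _ continuous_fst).add (hc _ continuous_snd))
  have hFA : ∀ z ∈ A, 0 < F z := by
    rintro ⟨u, v⟩ ⟨h1, h2⟩
    refine sub_pos.2 (norm_combo_rpow_lt hp ht0 ht1 ?_)
    intro (huv : u = v)
    subst huv
    simp only [mem_ofPred_eq, sub_self, norm_zero, Real.zero_rpow hp0.ne'] at h2
    have h3 : ‖u‖ = 1 := by simpa [Prod.norm_def] using h1
    rw [h3, Real.one_rpow] at h2
    linarith
  obtain ⟨c, hc0, hcA⟩ : ∃ c : ℝ, 0 < c ∧ ∀ z ∈ A, c ≤ F z := by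
    rcases A.eq_empty_or_nonempty with h | h
    · exact ⟨1, one_pos, by simp [h]⟩
    · obtain ⟨z, hz, hmin⟩ := hAc.exists_isMinOn h hFc.continuousOn
      exact ⟨F z, hFA z hz, fun y hy => hmin hy⟩
  have key : ∀ z : V × V, ‖z‖ = 1 → ‖z.1 - z.2‖ ^ p ≤ ε * (‖z.1‖ ^ p + ‖z.2‖ ^ p) +
      2 ^ p / c * F z := by
    intro z hz
    have hn1 : 0 ≤ ‖z.1‖ ^ p := by positivity
    have hn2 : 0 ≤ ‖z.2‖ ^ p := by positivity
    by_cases h : ε * (‖z.1‖ ^ p + ‖z.2‖ ^ p) ≤ ‖z.1 - z.2‖ ^ p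
    · have h1 : ‖z.1 - z.2‖ ≤ 2 := by
        have := norm_sub_le z.1 z.2
        have := norm_fst_le z
        have := norm_snd_le z
        linarith
      have h2 : ‖z.1 - z.2‖ ^ p ≤ 2 ^ p := Real.rpow_le_rpow (norm_nonneg _) h1 hp0.le
      have h3 : c ≤ F z := hcA z ⟨by simpa using hz, h⟩
      have h4 : (2 : ℝ) ^ p ≤ 2 ^ p / c * F z := by
        rw [div_mul_eq_mul_div, le_div_iff₀ hc0]
        gcongr
      have : 0 ≤ ε * (‖z.1‖ ^ p + ‖z.2‖ ^ p) := by positivity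
      linarith
    · have : 0 ≤ 2 ^ p / c * F z := mul_nonneg (by positivity) (hF0 z)
      linarith
  refine ⟨2 ^ p / c, by positivity, fun u v => ?_⟩
  by_cases h0 : ((u, v) : V × V) = 0
  · obtain ⟨rfl, rfl⟩ := Prod.mk_eq_zero.1 h0
    simp [Real.zero_rpow hp0.ne']
  -- Both sides are homogeneous of degree `p`, so the sphere suffices.
  set r := ‖((u, v) : V × V)‖ with hr
  have hr0 : 0 < r := norm_pos_iff.2 h0
  have h1 := key (r⁻¹ • (u, v)) (by rw [norm_smul, norm_inv, Real.norm_of_nonneg hr0.le, ← hr,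
    inv_mul_cancel₀ hr0.ne'])
  have hsc : ∀ w : V, ‖r⁻¹ • w‖ ^ p = (r ^ p)⁻¹ * ‖w‖ ^ p := fun w => by
    rw [norm_smul, norm_inv, Real.norm_of_nonneg hr0.le,
      Real.mul_rpow (by positivity) (norm_nonneg _), Real.inv_rpow hr0.le]
  simp only [hF, Prod.smul_fst, Prod.smul_snd, ← smul_sub, smul_comm _ r⁻¹, ← smul_add,
    hsc] at h1
  have hrp : 0 < r ^ p := by positivity
  have h2 := mul_le_mul_of_nonneg_left h1 hrp.le
  have e : ∀ X, r ^ p * ((r ^ p)⁻¹ * X) = X := fun X => by field_simp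
  rw [e] at h2
  refine h2.trans_eq ?_
  field_simp

/-! ### Semiconcavity of `‖·‖ ^ p` and of powers of the distance -/

theorem hasDerivAt_mul_sq_sub_rpow {p C : ℝ} (hp : 1 ≤ p) (x : ℝ) :
    HasDerivAt (fun r : ℝ => C * r ^ 2 - r ^ p) (C * (2 * x) - p * x ^ (p - 1)) x := by
  refine (((hasDerivAt_pow 2 x).const_mul C).sub
    (Real.hasDerivAt_rpow_const (x := x) (p := p) (Or.inr hp))).congr_deriv ?_
  simp

theorem convexOn_mul_sq_sub_rpow {p R C : ℝ} (hp : 2 ≤ p) (hC : p * (p - 1) * R ^ (p - 2) ≤ 2 * C) :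
    ConvexOn ℝ (Icc 0 R) fun r : ℝ => C * r ^ 2 - r ^ p := by
  have hd := hasDerivAt_mul_sq_sub_rpow (C := C) (by linarith : 1 ≤ p)
  have hd2 : ∀ x : ℝ, HasDerivAt (fun x : ℝ => C * (2 * x) - p * x ^ (p - 1))
      (C * 2 - p * ((p - 1) * x ^ (p - 2))) x := fun x => by
    refine ((((hasDerivAt_id x).const_mul 2).const_mul C).sub
      ((Real.hasDerivAt_rpow_const (x := x) (p := p - 1)
        (Or.inr (by linarith))).const_mul p)).congr_deriv ?_
    rw [show p - 1 - 1 = p - 2 by ring, mul_one]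
  refine convexOn_of_hasDerivWithinAt2_nonneg (convex_Icc _ _)
    (fun x _ => (hd x).continuousAt.continuousWithinAt)
    (fun x _ => (hd x).hasDerivWithinAt) (fun x _ => (hd2 x).hasDerivWithinAt) fun x hx => ?_
  rw [interior_Icc] at hx
  have h1 : x ^ (p - 2) ≤ R ^ (p - 2) :=
    Real.rpow_le_rpow hx.1.le hx.2.le (by linarith)
  have h2 : p * (p - 1) * x ^ (p - 2) ≤ p * (p - 1) * R ^ (p - 2) :=
    mul_le_mul_of_nonneg_left h1 (mul_nonneg (by linarith) (by linarith))
  linarith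

theorem monotoneOn_mul_sq_sub_rpow {p R C : ℝ} (hp : 2 ≤ p)
    (hC : p * R ^ (p - 2) ≤ 2 * C) :
    MonotoneOn (fun r : ℝ => C * r ^ 2 - r ^ p) (Icc 0 R) := by
  have hd := hasDerivAt_mul_sq_sub_rpow (C := C) (by linarith : 1 ≤ p)
  refine monotoneOn_of_hasDerivWithinAt_nonneg (convex_Icc _ _)
    (fun x _ => (hd x).continuousAt.continuousWithinAt)
    (fun x _ => (hd x).hasDerivWithinAt) fun x hx => ?_
  rw [interior_Icc] at hx
  have h1 : x ^ (p - 2) ≤ R ^ (p - 2) :=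
    Real.rpow_le_rpow hx.1.le hx.2.le (by linarith)
  have h2 : x ^ (p - 1) = x ^ (p - 2) * x := by
    rw [← Real.rpow_add_one hx.1.ne']
    ring_nf
  have h3 : p * x ^ (p - 2) ≤ p * R ^ (p - 2) := mul_le_mul_of_nonneg_left h1 (by linarith)
  have h4 := mul_le_mul_of_nonneg_right (h3.trans hC) hx.1.le
  rw [h2]
  linarith

theorem norm_combo_sq {V : Type*} [NormedAddCommGroup V] [InnerProductSpace ℝ V] (t : ℝ)
    (u w : V) : ‖(1 - t) • u + t • w‖ ^ 2 =
      (1 - t) * ‖u‖ ^ 2 + t * ‖w‖ ^ 2 - t * (1 - t) * ‖u - w‖ ^ 2 := by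
  rw [norm_add_sq_real, norm_sub_sq_real, norm_smul, norm_smul, inner_smul_left, inner_smul_right,
    mul_pow, mul_pow, Real.norm_eq_abs, Real.norm_eq_abs, sq_abs, sq_abs]
  simp
  ring

/-- On `[0, R]` the function `C * r ^ 2 - r ^ p` is convex and nondecreasing, so its composition
with the norm is convex on the ball. The exact identity `norm_combo_sq` turns the quadratic part
into the error term. -/
theorem combo_norm_rpow_le_of_two_le {V : Type*} [NormedAddCommGroup V] [InnerProductSpace ℝ V]
    {p R t : ℝ} (hp : 2 ≤ p) (ht0 : 0 ≤ t) (ht1 : t ≤ 1) {u w : V} (hu : ‖u‖ ≤ R) (hw : ‖w‖ ≤ R) :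
    (1 - t) * ‖u‖ ^ p + t * ‖w‖ ^ p ≤ ‖(1 - t) • u + t • w‖ ^ p +
      p * (p - 1) * R ^ (p - 2) * (t * (1 - t) * ‖u - w‖ ^ 2) := by
  have hR : 0 ≤ R := (norm_nonneg _).trans hu
  have hRp : 0 ≤ R ^ (p - 2) := by positivity
  have hpp : 0 ≤ p * (p - 1) * R ^ (p - 2) :=
    mul_nonneg (mul_nonneg (by linarith) (by linarith)) hRp
  set C := p * (p - 1) * R ^ (p - 2) with hC
  have hconv := convexOn_mul_sq_sub_rpow (p := p) (R := R) (C := C) hp (by linarith)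
  have hmono := monotoneOn_mul_sq_sub_rpow (p := p) (R := R) (C := C) hp (by
    have : p * R ^ (p - 2) * 1 ≤ p * R ^ (p - 2) * (p - 1) :=
      mul_le_mul_of_nonneg_left (by linarith) (mul_nonneg (by linarith) hRp)
    have e : C = p * R ^ (p - 2) * (p - 1) := by rw [hC]; ring
    linarith)
  have hs : 0 ≤ 1 - t := by linarith
  have h1 : ‖(1 - t) • u + t • w‖ ≤ (1 - t) * ‖u‖ + t * ‖w‖ := by
    refine (norm_add_le _ _).trans_eq ?_
    rw [norm_smul, norm_smul, Real.norm_of_nonneg ht0, Real.norm_of_nonneg hs]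
  have h2 : (1 - t) * ‖u‖ + t * ‖w‖ ≤ R := by
    have := mul_le_mul_of_nonneg_left hu hs
    have := mul_le_mul_of_nonneg_left hw ht0
    linarith
  have h3 := hmono ⟨norm_nonneg _, h1.trans h2⟩ ⟨(norm_nonneg _).trans h1, h2⟩ h1
  have h4 := hconv.2 ⟨norm_nonneg u, hu⟩ ⟨norm_nonneg w, hw⟩ hs ht0 (by ring)
  simp only [smul_eq_mul] at h3 h4
  have h5 := norm_combo_sq t u w
  have h6 := h3.trans h4
  rw [h5] at h6
  linarith

/-- First-order upper expansion of `‖·‖ ^ p` for `1 ≤ p ≤ 2`. -/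
theorem norm_add_rpow_le {V : Type*} [NormedAddCommGroup V] [InnerProductSpace ℝ V]
    {p : ℝ} (hp1 : 1 < p) (hp2 : p ≤ 2) (v a : V) :
    ‖v + a‖ ^ p ≤ ‖v‖ ^ p + p * ‖v‖ ^ (p - 2) * inner ℝ v a + (2 ^ p + p) * ‖a‖ ^ p := by
  have hp0 : 0 < p := by linarith
  have hap : 0 ≤ ‖a‖ ^ p := by positivity
  have h2p : 0 < (2 : ℝ) ^ p := by positivity
  rcases eq_or_ne v 0 with rfl | hv
  · simp only [zero_add, norm_zero, inner_zero_left, mul_zero, add_zero, Real.zero_rpow hp0.ne']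
    have := Real.one_le_rpow (x := 2) (by norm_num) hp0.le
    nlinarith
  have hv0 : 0 < ‖v‖ := norm_pos_iff.2 hv
  have hvp : ‖v‖ ^ (p - 2) * ‖v‖ = ‖v‖ ^ (p - 1) := by
    rw [← Real.rpow_add_one hv0.ne']; ring_nf
  have hvp2 : ‖v‖ ^ (p - 2) * ‖v‖ ^ 2 = ‖v‖ ^ p := by
    rw [← Real.rpow_natCast, ← Real.rpow_add hv0]; norm_num
  have hvn : 0 ≤ ‖v‖ ^ (p - 2) := by positivity
  -- For small `a`, Bernoulli's inequality with exponent `p / 2 ≤ 1` is applied to `‖v + a‖ ^ 2 /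
  -- ‖v‖ ^ 2`. For large `a`, the left side is at most `2 ^ p * ‖a‖ ^ p` and the linear term is at
  -- least `-p * ‖a‖ ^ p`; hence the constant `2 ^ p + p`.
  rcases le_or_gt ‖a‖ ‖v‖ with h | h
  · have hsq : ‖v + a‖ ^ p = ‖v‖ ^ p * (1 + (‖v + a‖ ^ 2 / ‖v‖ ^ 2 - 1)) ^ (p / 2) := by
      rw [add_sub_cancel, Real.div_rpow (by positivity) (by positivity), ← Real.rpow_natCast,
        ← Real.rpow_natCast, ← Real.rpow_mul (norm_nonneg _), ← Real.rpow_mul (norm_nonneg _)]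
      have : ((2 : ℕ) : ℝ) * (p / 2) = p := by push_cast; ring
      rw [this]
      field_simp
    have hb := rpow_one_add_le_one_add_mul_self (s := ‖v + a‖ ^ 2 / ‖v‖ ^ 2 - 1)
      (p := p / 2) (by have : 0 ≤ ‖v + a‖ ^ 2 / ‖v‖ ^ 2 := by positivity
                       linarith) (by linarith) (by linarith)
    have h1 : ‖v + a‖ ^ p ≤ ‖v‖ ^ p + p / 2 * (‖v‖ ^ (p - 2) * (‖v + a‖ ^ 2 - ‖v‖ ^ 2)) := by
      rw [hsq]
      refine (mul_le_mul_of_nonneg_left hb (by positivity)).trans_eq ?_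
      rw [← hvp2]
      field_simp
    have h2 : ‖v‖ ^ (p - 2) * ‖a‖ ^ 2 ≤ ‖a‖ ^ p := by
      rcases eq_or_ne a 0 with rfl | ha
      · simp [Real.zero_rpow hp0.ne']
      have ha0 : 0 < ‖a‖ := norm_pos_iff.2 ha
      have : ‖v‖ ^ (p - 2) ≤ ‖a‖ ^ (p - 2) :=
        Real.rpow_le_rpow_of_nonpos ha0 h (by linarith)
      refine (mul_le_mul_of_nonneg_right this (by positivity)).trans_eq ?_
      rw [← Real.rpow_natCast, ← Real.rpow_add ha0]
      norm_num
    rw [norm_add_sq_real] at h1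
    have h3 : p / 2 * (‖v‖ ^ (p - 2) * ‖a‖ ^ 2) ≤ p * ‖a‖ ^ p := by nlinarith
    nlinarith
  · have h1 : ‖v + a‖ ^ p ≤ 2 ^ p * ‖a‖ ^ p := by
      rw [← Real.mul_rpow (by norm_num) (norm_nonneg _)]
      refine Real.rpow_le_rpow (norm_nonneg _) ?_ hp0.le
      linarith [norm_add_le v a]
    have h2 : -(‖v‖ * ‖a‖) ≤ inner ℝ v a := (abs_le.1 (abs_real_inner_le_norm v a)).1
    have h3 : -(‖v‖ ^ (p - 1) * ‖a‖) ≤ ‖v‖ ^ (p - 2) * inner ℝ v a := by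
      rw [← hvp]
      nlinarith [mul_le_mul_of_nonneg_left h2 hvn]
    have h4 : ‖v‖ ^ (p - 1) * ‖a‖ ≤ ‖a‖ ^ p := by
      have ha0 : 0 < ‖a‖ := hv0.trans h
      have : ‖v‖ ^ (p - 1) ≤ ‖a‖ ^ (p - 1) := Real.rpow_le_rpow hv0.le h.le (by linarith)
      refine (mul_le_mul_of_nonneg_right this ha0.le).trans_eq ?_
      rw [← Real.rpow_add_one ha0.ne']
      ring_nf
    have h5 : 0 ≤ ‖v‖ ^ p := by positivity
    nlinarith

/-- Expanding at the intermediate point, the increments `t • (u - w)` and `-(1 - t) • (u - w)` have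
weighted mean zero, so the linear terms cancel. The remainders carry `(1 - t) * t ^ p + t * (1 - t)
^ p ≤ 2 * t * (1 - t)`. -/
theorem combo_norm_rpow_le_of_le_two {V : Type*} [NormedAddCommGroup V] [InnerProductSpace ℝ V]
    {p t : ℝ} (hp1 : 1 < p) (hp2 : p ≤ 2) (ht0 : 0 ≤ t) (ht1 : t ≤ 1) (u w : V) :
    (1 - t) * ‖u‖ ^ p + t * ‖w‖ ^ p ≤ ‖(1 - t) • u + t • w‖ ^ p +
      2 * (2 ^ p + p) * (t * (1 - t) * ‖u - w‖ ^ p) := by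
  have hs : 0 ≤ 1 - t := by linarith
  set v := (1 - t) • u + t • w with hv
  have hu : u = v + t • (u - w) := by rw [hv]; module
  have hw : w = v + (-(1 - t)) • (u - w) := by rw [hv]; module
  have h1 := norm_add_rpow_le hp1 hp2 v (t • (u - w))
  have h2 := norm_add_rpow_le hp1 hp2 v ((-(1 - t)) • (u - w))
  rw [← hu, inner_smul_right, norm_smul, Real.norm_of_nonneg ht0,
    Real.mul_rpow ht0 (norm_nonneg _)] at h1
  rw [← hw, inner_smul_right, norm_smul, norm_neg, Real.norm_of_nonneg hs,
    Real.mul_rpow hs (norm_nonneg _)] at h2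
  have hpow : ∀ s : ℝ, 0 ≤ s → s ≤ 1 → s ^ p ≤ s := fun s h0 h1 => by
    simpa using Real.rpow_le_rpow_of_exponent_ge' h0 h1 zero_le_one hp1.le
  have hC : 0 ≤ (2 ^ p + p) * ‖u - w‖ ^ p := by positivity
  have e1 := mul_le_mul_of_nonneg_left h1 hs
  have e2 := mul_le_mul_of_nonneg_left h2 ht0
  have e3 := mul_le_mul_of_nonneg_right (mul_le_mul_of_nonneg_left (hpow t ht0 ht1) hs) hC
  have e4 := mul_le_mul_of_nonneg_right
    (mul_le_mul_of_nonneg_left (hpow (1 - t) hs (by linarith)) ht0) hC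
  linarith

/-- The `p`-th power of the distance from a closed set is semiconcave on bounded sets. -/
theorem exists_combo_infDist_rpow_le {V : Type*} [NormedAddCommGroup V] [InnerProductSpace ℝ V]
    [ProperSpace V] {p : ℝ} (hp : 1 < p) {S K : Set V} (hS : IsClosed S) (hSn : S.Nonempty)
    (hK : IsCompact K) (hKc : Convex ℝ K) :
    ∃ C : ℝ, 0 < C ∧ ∀ x ∈ K, ∀ y ∈ K, ∀ t : ℝ, 0 ≤ t → t ≤ 1 →
      (1 - t) * Metric.infDist x S ^ p + t * Metric.infDist y S ^ p ≤
        Metric.infDist ((1 - t) • x + t • y) S ^ p +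
          C * (t * (1 - t) * ‖x - y‖ ^ min p 2) := by
  obtain ⟨R₁, hR₁⟩ := (hK.image (Metric.continuous_infDist_pt S)).bddAbove
  set R := |R₁| + Metric.diam K with hR
  have hR0 : 0 ≤ R := add_nonneg (abs_nonneg _) Metric.diam_nonneg
  -- The sum of the constants for `p ≤ 2` and for `p ≥ 2` serves both cases.
  refine ⟨2 * (2 ^ p + p) + p * (p - 1) * R ^ (p - 2), ?_, fun x hx y hy t ht0 ht1 => ?_⟩
  · have : 0 ≤ p * (p - 1) * R ^ (p - 2) :=
      mul_nonneg (mul_nonneg (by linarith) (by linarith)) (by positivity)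
    have : 0 < (2 : ℝ) ^ p := by positivity
    linarith
  have hs : 0 ≤ 1 - t := by linarith
  set z := (1 - t) • x + t • y with hz
  have hzK : z ∈ K := hKc hx hy hs ht0 (by ring)
  -- Replacing `S` by the nearest point `s` of `z` keeps the distance at `z` and can only increase
  -- it at `x` and `y`.
  obtain ⟨s, hsS, hzs⟩ := hS.exists_infDist_eq_dist hSn z
  have hzs' : ‖z - s‖ ≤ |R₁| := by
    rw [← dist_eq_norm, ← hzs]
    exact (hR₁ ⟨z, hzK, rfl⟩).trans (le_abs_self _)
  have hb : ∀ q ∈ K, ‖q - s‖ ≤ R := fun q hq => by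
    have h1 := Metric.dist_le_diam_of_mem hK.isBounded hq hzK
    have h2 := norm_sub_le_norm_sub_add_norm_sub q z s
    rw [dist_eq_norm] at h1
    linarith
  have hd : ∀ q, Metric.infDist q S ^ p ≤ ‖q - s‖ ^ p := fun q => by
    rw [← dist_eq_norm]
    exact Real.rpow_le_rpow Metric.infDist_nonneg (Metric.infDist_le_dist_of_mem hsS) (by linarith)
  have e1 := mul_le_mul_of_nonneg_left (hd x) hs
  have e2 := mul_le_mul_of_nonneg_left (hd y) ht0
  rw [hzs, dist_eq_norm]
  have hzc : z - s = (1 - t) • (x - s) + t • (y - s) := by rw [hz]; module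
  have hxy : x - y = (x - s) - (y - s) := by abel
  rw [hzc, hxy]
  refine (add_le_add e1 e2).trans ?_
  have htt : 0 ≤ t * (1 - t) := mul_nonneg ht0 hs
  rcases le_total p 2 with h | h
  · refine (combo_norm_rpow_le_of_le_two hp h ht0 ht1 _ _).trans ?_
    rw [min_eq_left h]
    gcongr
    have : 0 ≤ p * (p - 1) * R ^ (p - 2) :=
      mul_nonneg (mul_nonneg (by linarith) (by linarith)) (by positivity)
    linarith
  · refine (combo_norm_rpow_le_of_two_le h ht0 ht1 (hb x hx) (hb y hy)).trans ?_
    rw [min_eq_right h, Real.rpow_two]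
    gcongr
    have : 0 < (2 : ℝ) ^ p := by positivity
    linarith

/-! ### `L^p` inequalities with a real exponent -/

section Lp

variable {α : Type*} [MeasurableSpace α] {ρ : Measure α}

theorem memLp_ofReal_iff {F : Type*} [NormedAddCommGroup F] {p : ℝ} (hp : 1 ≤ p) {f : α → F}
    (hf : AEStronglyMeasurable f ρ) :
    MemLp f (ENNReal.ofReal p) ρ ↔ ∫⁻ x, ‖f x‖ₑ ^ p ∂ρ < ∞ := by
  have h0 : ENNReal.ofReal p ≠ 0 := by simp; linarith
  have h1 := eLpNorm_lt_top_iff_lintegral_rpow_enorm_lt_top (f := f) (μ := ρ) h0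
    ENNReal.ofReal_ne_top
  rw [ENNReal.toReal_ofReal (by linarith)] at h1
  rw [← h1]
  exact ⟨fun h => h.2, fun h => ⟨hf, h⟩⟩

theorem MemLp.integrable_rpow {F : Type*} [NormedAddCommGroup F] {p : ℝ} (hp : 1 ≤ p) {f : α → F}
    (hf : MemLp f (ENNReal.ofReal p) ρ) : Integrable (fun x => ‖f x‖ ^ p) ρ := by
  have h0 : ENNReal.ofReal p ≠ 0 := by simp; linarith
  simpa [ENNReal.toReal_ofReal (by linarith : 0 ≤ p)] using
    hf.integrable_norm_rpow h0 ENNReal.ofReal_ne_top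

theorem lintegral_enorm_rpow_eq {F : Type*} [NormedAddCommGroup F] {p : ℝ} (hp : 1 ≤ p)
    {f : α → F} (hf : MemLp f (ENNReal.ofReal p) ρ) :
    ∫⁻ x, ‖f x‖ₑ ^ p ∂ρ = ENNReal.ofReal (∫ x, ‖f x‖ ^ p ∂ρ) := by
  rw [ofReal_integral_eq_lintegral_ofReal (MemLp.integrable_rpow hp hf)
    (ae_of_all _ fun x => by positivity)]
  refine lintegral_congr fun x => ?_
  rw [← ENNReal.ofReal_rpow_of_nonneg (norm_nonneg _) (by linarith), ofReal_norm]

/-- Minkowski's inequality for nonnegative real functions. -/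
theorem integral_add_rpow_le {p : ℝ} (hp : 1 ≤ p) {f g : α → ℝ} (hf0 : 0 ≤ f) (hg0 : 0 ≤ g)
    (hf : MemLp f (ENNReal.ofReal p) ρ) (hg : MemLp g (ENNReal.ofReal p) ρ) :
    (∫ x, (f x + g x) ^ p ∂ρ) ^ (1 / p) ≤
      (∫ x, f x ^ p ∂ρ) ^ (1 / p) + (∫ x, g x ^ p ∂ρ) ^ (1 / p) := by
  have h0 : ENNReal.ofReal p ≠ 0 := by simp; linarith
  have h1 := eLpNorm_add_le hf.1 hg.1 (ENNReal.one_le_ofReal.2 hp)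
  rw [(hf.add hg).eLpNorm_eq_integral_rpow_norm h0 ENNReal.ofReal_ne_top,
    hf.eLpNorm_eq_integral_rpow_norm h0 ENNReal.ofReal_ne_top,
    hg.eLpNorm_eq_integral_rpow_norm h0 ENNReal.ofReal_ne_top,
    ENNReal.toReal_ofReal (by linarith), ← ENNReal.ofReal_add (by positivity) (by positivity),
    ENNReal.ofReal_le_ofReal_iff (by positivity), ← one_div] at h1
  have e1 : ∀ x, ‖f x‖ = f x := fun x => Real.norm_of_nonneg (hf0 x)
  have e2 : ∀ x, ‖g x‖ = g x := fun x => Real.norm_of_nonneg (hg0 x)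
  have e3 : ∀ x, ‖(f + g) x‖ = f x + g x := fun x =>
    Real.norm_of_nonneg (add_nonneg (hf0 x) (hg0 x))
  simpa only [e1, e2, e3] using h1

theorem integral_rpow_le_rpow_integral [IsProbabilityMeasure ρ] {F : Type*}
    [NormedAddCommGroup F] {p q : ℝ} (hq : 1 ≤ q) (hqp : q ≤ p) {f : α → F}
    (hf : MemLp f (ENNReal.ofReal p) ρ) :
    ∫ x, ‖f x‖ ^ q ∂ρ ≤ (∫ x, ‖f x‖ ^ p ∂ρ) ^ (q / p) := by
  have hq0 : ENNReal.ofReal q ≠ 0 := by simp; linarith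
  have hp0 : ENNReal.ofReal p ≠ 0 := by simp; linarith
  have hle := ENNReal.ofReal_le_ofReal hqp
  have h1 := eLpNorm_le_eLpNorm_of_exponent_le hle hf.1
  have hIq : 0 ≤ ∫ x, ‖f x‖ ^ q ∂ρ := integral_nonneg fun x => by positivity
  have hIp : 0 ≤ ∫ x, ‖f x‖ ^ p ∂ρ := integral_nonneg fun x => by positivity
  rw [(hf.mono_exponent hle).eLpNorm_eq_integral_rpow_norm hq0 ENNReal.ofReal_ne_top,
    hf.eLpNorm_eq_integral_rpow_norm hp0 ENNReal.ofReal_ne_top,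
    ENNReal.toReal_ofReal (by linarith), ENNReal.toReal_ofReal (by linarith),
    ENNReal.ofReal_le_ofReal_iff (by positivity)] at h1
  have h2 := Real.rpow_le_rpow (by positivity) h1 (by linarith : 0 ≤ q)
  rw [← Real.rpow_mul hIq, ← Real.rpow_mul hIp, inv_mul_cancel₀ (by linarith), Real.rpow_one] at h2
  rwa [div_eq_inv_mul]

end Lp

/-! ### Transport plans and the Wasserstein distance -/

variable {d : ℕ} {p : ℝ} {μ ν ρ : ProbabilityMeasure (E d)}

theorem mem_probP_iff_memLp (hp : 1 ≤ p) :
    μ ∈ probP d p ↔ MemLp (fun x : E d => x) (ENNReal.ofReal p) (μ : Measure (E d)) :=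
  (memLp_ofReal_iff hp aestronglyMeasurable_id).symm

theorem MemLp.comp_of_map_eq {α β F : Type*} [MeasurableSpace α] [MeasurableSpace β]
    [NormedAddCommGroup F] {ρ : Measure α} {σ : Measure β} {q : ℝ≥0∞} {g : α → β}
    (hg : Measurable g) (h : ρ.map g = σ) {f : β → F} (hf : MemLp f q σ) :
    MemLp (fun x => f (g x)) q ρ := by
  subst h
  exact hf.comp_measurePreserving ⟨hg, rfl⟩

theorem memLp_sub_of_mem_plans (hp : 1 ≤ p) (hμ : μ ∈ probP d p) (hν : ν ∈ probP d p)
    {π : ProbabilityMeasure (E d × E d)} (hπ : π ∈ plans μ ν) :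
    MemLp (fun z : E d × E d => z.1 - z.2) (ENNReal.ofReal p) (π : Measure (E d × E d)) :=
  (MemLp.comp_of_map_eq measurable_fst hπ.1 ((mem_probP_iff_memLp hp).1 hμ)).sub
    (MemLp.comp_of_map_eq measurable_snd hπ.2 ((mem_probP_iff_memLp hp).1 hν))

theorem W_nonneg : 0 ≤ W p μ ν := Real.rpow_nonneg ENNReal.toReal_nonneg _

theorem W_rpow (hp : 1 ≤ p) : W p μ ν ^ p = (cost p μ ν).toReal := by
  rw [W, ← Real.rpow_mul ENNReal.toReal_nonneg, one_div_mul_cancel (by linarith), Real.rpow_one]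

theorem W_rpow_le (hp : 1 ≤ p) (hμ : μ ∈ probP d p) (hν : ν ∈ probP d p)
    {π : ProbabilityMeasure (E d × E d)} (hπ : π ∈ plans μ ν) :
    W p μ ν ^ p ≤ ∫ z, ‖z.1 - z.2‖ ^ p ∂(π : Measure (E d × E d)) := by
  rw [W_rpow hp]
  refine ENNReal.toReal_le_of_le_ofReal (by positivity) ?_
  rw [← lintegral_enorm_rpow_eq hp (memLp_sub_of_mem_plans hp hμ hν hπ)]
  exact iInf₂_le π hπ

/-- Almost optimal plans replace minimizers throughout, so existence of an optimal plan is never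
needed. -/
theorem exists_plan_integral_le (hp : 1 ≤ p) (hμ : μ ∈ probP d p) (hν : ν ∈ probP d p)
    {δ : ℝ} (hδ : 0 < δ) :
    ∃ π ∈ plans μ ν, ∫ z, ‖z.1 - z.2‖ ^ p ∂(π : Measure (E d × E d)) ≤ W p μ ν ^ p + δ := by
  have hlt : cost p μ ν < ENNReal.ofReal (W p μ ν ^ p + δ) := by
    rw [W_rpow hp, ENNReal.lt_ofReal_iff_toReal_lt (cost_lt_top hp hμ hν).ne]
    linarith
  simp only [cost, iInf_lt_iff] at hlt
  obtain ⟨π, hπ, h⟩ := hlt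
  refine ⟨π, hπ, ?_⟩
  rw [lintegral_enorm_rpow_eq hp (memLp_sub_of_mem_plans hp hμ hν hπ)] at h
  exact (ENNReal.ofReal_lt_ofReal_iff'.1 h).1.le

theorem memLp_infDist (hp : 1 ≤ p) (hμ : μ ∈ probP d p) (S : Set (E d)) :
    MemLp (fun x => Metric.infDist x S) (ENNReal.ofReal p) (μ : Measure (E d)) := by
  refine (((mem_probP_iff_memLp hp).1 hμ).norm.add (memLp_const (Metric.infDist 0 S))).mono
    (Metric.continuous_infDist_pt S).aestronglyMeasurable (ae_of_all _ fun x => ?_)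
  have h := Metric.infDist_le_infDist_add_dist (s := S) (x := x) (y := 0)
  rw [dist_zero_right] at h
  rw [Real.norm_of_nonneg Metric.infDist_nonneg]
  refine le_trans ?_ (le_abs_self _)
  simp only [Pi.add_apply]
  linarith

theorem ae_mem_of_support_subset {S : Set (E d)} (h : (μ : Measure (E d)).support ⊆ S) :
    ∀ᵐ x ∂(μ : Measure (E d)), x ∈ S :=
  Filter.mem_of_superset Measure.support_mem_ae h

theorem ae_of_map_eq {α β : Type*} [MeasurableSpace α] [MeasurableSpace β]
    {ρ : Measure α} {σ : Measure β} {g : α → β} (hg : Measurable g) (h : ρ.map g = σ)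
    {P : β → Prop} (hP : ∀ᵐ x ∂σ, P x) : ∀ᵐ x ∂ρ, P (g x) := by
  subst h
  exact ae_of_ae_map hg.aemeasurable hP

theorem integral_comp_of_map_eq {α β : Type*} [MeasurableSpace α] [MeasurableSpace β]
    [TopologicalSpace β] [OpensMeasurableSpace β] [TopologicalSpace.PseudoMetrizableSpace β]
    {ρ : Measure α} {σ : Measure β} {g : α → β} (hg : Measurable g) (h : ρ.map g = σ) {f : β → ℝ}
    (hf : Continuous f) : ∫ x, f (g x) ∂ρ = ∫ y, f y ∂σ := by
  subst h
  exact (integral_map hg.aemeasurable hf.measurable.aestronglyMeasurable).symm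

/-! ### The generalized distance as an integral -/

theorem continuous_infDist_rpow (hp : 1 ≤ p) (S : Set (E d)) :
    Continuous fun x : E d => Metric.infDist x S ^ p :=
  (Metric.continuous_infDist_pt S).rpow_const fun _ => Or.inr (by linarith)

theorem integrable_infDist_rpow (hp : 1 ≤ p) (hμ : μ ∈ probP d p) (S : Set (E d)) :
    Integrable (fun x => Metric.infDist x S ^ p) (μ : Measure (E d)) := by
  simpa only [Real.norm_of_nonneg Metric.infDist_nonneg] using
    MemLp.integrable_rpow hp (memLp_infDist hp hμ S)

/-- Under any plan the second coordinate lies in `S` almost surely, so the displacement is at least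
the distance of the first coordinate from `S`. -/
theorem integral_infDist_rpow_le_W (hp : 1 ≤ p) (hμ : μ ∈ probP d p) (hν : ν ∈ probP d p)
    {S : Set (E d)} (hνS : (ν : Measure (E d)).support ⊆ S) :
    ∫ x, Metric.infDist x S ^ p ∂(μ : Measure (E d)) ≤ W p μ ν ^ p := by
  refine le_of_forall_pos_le_add fun δ hδ => ?_
  obtain ⟨π, hπ, h⟩ := exists_plan_integral_le hp hμ hν hδ
  refine le_trans ?_ h
  rw [← integral_comp_of_map_eq measurable_fst hπ.1 (continuous_infDist_rpow hp S)]
  refine integral_mono_of_nonneg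
    (ae_of_all _ fun z => Real.rpow_nonneg Metric.infDist_nonneg _)
    (MemLp.integrable_rpow hp (memLp_sub_of_mem_plans hp hμ hν hπ)) ?_
  filter_upwards [ae_of_map_eq measurable_snd hπ.2 (ae_mem_of_support_subset hνS)] with z hz
  refine Real.rpow_le_rpow Metric.infDist_nonneg ?_ (by linarith)
  rw [← dist_eq_norm]
  exact Metric.infDist_le_dist_of_mem hz

/-- Measurable almost-projections onto a nonempty set. -/
theorem exists_measurable_dist_le_infDist_add {X : Type*} [PseudoMetricSpace X]
    [SecondCountableTopology X] [MeasurableSpace X] [BorelSpace X] {S : Set X}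
    (hS : S.Nonempty) {ε : ℝ} (hε : 0 < ε) :
    ∃ f : X → X, Measurable f ∧ (∀ x, f x ∈ S) ∧ ∀ x, dist x (f x) ≤ Metric.infDist x S + ε := by
  classical
  have : Nonempty S := hS.to_subtype
  set s : ℕ → S := TopologicalSpace.denseSeq S with hs
  have hex : ∀ x : X, ∃ n, dist x (s n) < Metric.infDist x S + ε := fun x => by
    obtain ⟨y, hy, hxy⟩ := (Metric.infDist_lt_iff hS).1
      (by linarith : Metric.infDist x S < Metric.infDist x S + ε / 2)
    obtain ⟨n, hn⟩ := Metric.denseRange_iff.1 (TopologicalSpace.denseRange_denseSeq S)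
      ⟨y, hy⟩ (ε / 2) (by linarith)
    have hn' : dist y (s n) < ε / 2 := hn
    exact ⟨n, by linarith [dist_triangle x y (s n)]⟩
  -- Choosing the first admissible index in a dense sequence of `S` makes the selection measurable.
  have hmeas : Measurable fun x => Nat.find (hex x) :=
    measurable_find hex fun n => (isOpen_lt (by fun_prop)
      ((Metric.continuous_infDist_pt S).add continuous_const)).measurableSet
  refine ⟨fun x => s (Nat.find (hex x)), ?_, fun x => Subtype.coe_prop _,
    fun x => (Nat.find_spec (hex x)).le⟩
  exact (measurable_from_nat (f := fun n => (s n : X))).comp hmeas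

/-- The competitor is the image of `μ` under a measurable almost-projection, coupled to `μ` by its
graph; Minkowski's inequality splits off `ε`. -/
theorem exists_W_le_integral_infDist_rpow (hp : 1 ≤ p) (hμ : μ ∈ probP d p) {S : Set (E d)}
    (hS : IsClosed S) (hSn : S.Nonempty) {ε : ℝ} (hε : 0 < ε) :
    ∃ ν ∈ probP d p, (ν : Measure (E d)).support ⊆ S ∧
      W p μ ν ≤ (∫ x, Metric.infDist x S ^ p ∂(μ : Measure (E d))) ^ (1 / p) + ε := by
  obtain ⟨f, hf, hfS, hfd⟩ := exists_measurable_dist_le_infDist_add hSn hε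
  have hp0 : 0 < p := by linarith
  have hD := memLp_infDist hp hμ S
  have hDε : MemLp (fun x => Metric.infDist x S + ε) (ENNReal.ofReal p) (μ : Measure (E d)) :=
    hD.add (memLp_const ε)
  have hsub : MemLp (fun x => x - f x) (ENNReal.ofReal p) (μ : Measure (E d)) := by
    refine hDε.mono (measurable_id.sub hf).aestronglyMeasurable (ae_of_all _ fun x => ?_)
    rw [← dist_eq_norm]
    exact (hfd x).trans (le_abs_self _)
  have hfp : MemLp f (ENNReal.ofReal p) (μ : Measure (E d)) := by
    refine (((mem_probP_iff_memLp hp).1 hμ).sub hsub).ae_eq (ae_of_all _ fun x => ?_)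
    simp
  set ν : ProbabilityMeasure (E d) := μ.map hf.aemeasurable with hν
  have hνm : (ν : Measure (E d)) = (μ : Measure (E d)).map f := rfl
  have hνP : ν ∈ probP d p := by
    rw [mem_probP_iff_memLp hp, hνm]
    exact (memLp_map_measure_iff aestronglyMeasurable_id hf.aemeasurable).2 hfp
  refine ⟨ν, hνP, ?_, ?_⟩
  · refine Measure.support_subset_of_isClosed hS ?_
    rw [hνm, mem_ae_map_iff hf.aemeasurable hS.measurableSet]
    exact Filter.univ_mem' hfS
  have hg : Measurable fun x : E d => (x, f x) := measurable_id.prodMk hf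
  set π : ProbabilityMeasure (E d × E d) := μ.map hg.aemeasurable with hπ
  have hπm : (π : Measure (E d × E d)) = (μ : Measure (E d)).map fun x => (x, f x) := rfl
  have hmem : π ∈ plans μ ν := by
    constructor
    · rw [hπm, Measure.map_map measurable_fst hg]
      exact Measure.map_id
    · rw [hπm, Measure.map_map measurable_snd hg]
      rfl
  have h1 := W_rpow_le hp hμ hνP hmem
  have h2 : ∫ z, ‖z.1 - z.2‖ ^ p ∂(π : Measure (E d × E d)) ≤
      ∫ x, (Metric.infDist x S + ε) ^ p ∂(μ : Measure (E d)) := by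
    rw [← integral_comp_of_map_eq (f := fun z : E d × E d => ‖z.1 - z.2‖ ^ p) hg hπm.symm
      ((continuous_fst.sub continuous_snd).norm.rpow_const fun _ => Or.inr hp0.le)]
    refine integral_mono_of_nonneg (ae_of_all _ fun x => by positivity) ?_
      (ae_of_all _ fun x => ?_)
    · refine (MemLp.integrable_rpow hp hDε).congr (ae_of_all _ fun x => ?_)
      simp only []
      rw [Real.norm_of_nonneg (add_nonneg Metric.infDist_nonneg hε.le)]
    · refine Real.rpow_le_rpow (norm_nonneg _) ?_ hp0.le
      rw [← dist_eq_norm]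
      exact hfd x
  have h3 := integral_add_rpow_le hp (fun x => Metric.infDist_nonneg) (fun _ => hε.le) hD
    (memLp_const ε)
  have h4 : (∫ _, ε ^ p ∂(μ : Measure (E d))) ^ (1 / p) = ε := by
    rw [integral_const, probReal_univ, one_smul, ← Real.rpow_mul hε.le,
      mul_one_div_cancel hp0.ne', Real.rpow_one]
  rw [h4] at h3
  refine le_trans ?_ h3
  have h5 := Real.rpow_le_rpow (Real.rpow_nonneg W_nonneg p) (h1.trans h2)
    (by positivity : 0 ≤ 1 / p)
  rwa [← Real.rpow_mul W_nonneg, mul_one_div_cancel hp0.ne', Real.rpow_one] at h5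

/-- The generalized distance is the `L^p` norm of the distance from the classical counterpart. -/
theorem genDist_eq (hp : 1 ≤ p) (hμ : μ ∈ probP d p) {S : Set (E d)} (hS : IsClosed S)
    (hSn : S.Nonempty) {T : Set (ProbabilityMeasure (E d))} (hT : IsClassicalCounterpart p T S) :
    genDist p T μ = (∫ x, Metric.infDist x S ^ p ∂(μ : Measure (E d))) ^ (1 / p) := by
  have hp0 : 0 < p := by linarith
  rw [IsClassicalCounterpart] at hT
  have hI : 0 ≤ ∫ x, Metric.infDist x S ^ p ∂(μ : Measure (E d)) :=
    integral_nonneg fun x => Real.rpow_nonneg Metric.infDist_nonneg _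
  have hbdd : BddBelow (W p μ '' T) := ⟨0, by rintro _ ⟨ν, -, rfl⟩; exact W_nonneg⟩
  refine le_antisymm (le_of_forall_pos_le_add fun ε hε => ?_) ?_
  · obtain ⟨ν, hν, hνS, h⟩ := exists_W_le_integral_infDist_rpow hp hμ hS hSn hε
    exact (csInf_le hbdd ⟨ν, hT ▸ ⟨hνS, hν⟩, rfl⟩).trans h
  · obtain ⟨ν, hν, hνS, -⟩ := exists_W_le_integral_infDist_rpow hp hμ hS hSn one_pos
    refine le_csInf ⟨_, ν, hT ▸ ⟨hνS, hν⟩, rfl⟩ ?_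
    rintro _ ⟨ν, hν, rfl⟩
    rw [hT] at hν
    have h := Real.rpow_le_rpow hI (integral_infDist_rpow_le_W hp hμ hν.2 hν.1)
      (by positivity : 0 ≤ 1 / p)
    rwa [← Real.rpow_mul W_nonneg, mul_one_div_cancel hp0.ne', Real.rpow_one] at h

theorem genDist_rpow (hp : 1 ≤ p) (hμ : μ ∈ probP d p) {S : Set (E d)} (hS : IsClosed S)
    (hSn : S.Nonempty) {T : Set (ProbabilityMeasure (E d))} (hT : IsClassicalCounterpart p T S) :
    genDist p T μ ^ p = ∫ x, Metric.infDist x S ^ p ∂(μ : Measure (E d)) := by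
  rw [genDist_eq hp hμ hS hSn hT, ← Real.rpow_mul, one_div_mul_cancel (by linarith), Real.rpow_one]
  exact integral_nonneg fun x => Real.rpow_nonneg Metric.infDist_nonneg _

/-! ### Topology of the classical counterpart -/

theorem IsClassicalCounterpart.nonempty {S : Set (E d)} {T : Set (ProbabilityMeasure (E d))}
    (hT : IsClassicalCounterpart p T S) (hTn : T.Nonempty) : S.Nonempty := by
  obtain ⟨μ, hμ⟩ := hTn
  rw [hT] at hμ
  exact (Measure.nonempty_support (IsProbabilityMeasure.ne_zero _)).mono hμ.1

/-- Testing with the Dirac mass at `x` gives `x ∈ S` exactly when `φ x ≤ 0` for all `φ ∈ Φ`, so `S`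
is an intersection of closed sets. -/
theorem IsClassicalCounterpart.isClosed (hp : 1 ≤ p) {S : Set (E d)} {Φ : Set (E d →ᵇ ℝ)}
    (hT : IsClassicalCounterpart p (targetP p Φ) S) : IsClosed S := by
  have hdirac : ∀ x : E d, (⟨Measure.dirac x, inferInstance⟩ : ProbabilityMeasure (E d)) ∈
      probP d p := fun x => by
    change ∫⁻ y, ‖y‖ₑ ^ p ∂(Measure.dirac x) < ∞
    rw [lintegral_dirac]
    exact ENNReal.rpow_lt_top_of_nonneg (by linarith) (by simp)
  have hsupp : ∀ x : E d, (Measure.dirac x).support = {x} := fun x => by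
    refine (Set.Nonempty.subset_singleton_iff
      (Measure.nonempty_support (IsProbabilityMeasure.ne_zero _))).1 ?_
    refine Measure.support_subset_of_isClosed isClosed_singleton ?_
    rw [mem_ae_dirac_iff (measurableSet_singleton x)]
    rfl
  have hSeq : S = ⋂ φ ∈ Φ, {x | φ x ≤ 0} := by
    ext x
    have h1 : (⟨Measure.dirac x, inferInstance⟩ : ProbabilityMeasure (E d)) ∈ targetP p Φ ↔
        x ∈ S := by
      rw [hT]
      exact ⟨fun h => h.1 (by rw [ProbabilityMeasure.coe_mk, hsupp]; rfl), fun h =>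
        ⟨by change (Measure.dirac x).support ⊆ S; rw [hsupp]; exact singleton_subset_iff.2 h,
          hdirac x⟩⟩
    rw [← h1]
    simp only [mem_iInter]
    constructor
    · intro h φ hφ
      simpa using h.1 φ hφ
    · exact fun h => ⟨fun φ hφ => by simpa using h φ hφ, hdirac x⟩
  rw [hSeq]
  exact isClosed_biInter fun φ _ => isClosed_le φ.continuous continuous_const

/-! ### Gluing and approximate displacement interpolation -/

/-- Gluing of two transport plans along the common marginal. -/
theorem exists_gluing {π₁ π₂ : ProbabilityMeasure (E d × E d)} (h₁ : π₁ ∈ plans μ ρ)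
    (h₂ : π₂ ∈ plans ρ ν) :
    ∃ Q : Measure (E d × E d × E d), IsProbabilityMeasure Q ∧
      Q.map (fun z => (z.2.1, z.1)) = (π₁ : Measure (E d × E d)) ∧
      Q.map (fun z => (z.1, z.2.2)) = (π₂ : Measure (E d × E d)) := by
  -- The swap puts `ρ` first, so that both plans disintegrate over it.
  set σ : Measure (E d × E d) := (π₁ : Measure (E d × E d)).map Prod.swap with hσ
  have hσp : IsProbabilityMeasure σ := Measure.isProbabilityMeasure_map measurable_swap.aemeasurable
  have hσ1 : σ.fst = (ρ : Measure (E d)) := by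
    rw [Measure.fst, hσ, Measure.map_map measurable_fst measurable_swap]
    exact h₁.2
  have hπ1 : (π₂ : Measure (E d × E d)).fst = (ρ : Measure (E d)) := h₂.1
  have e1 := σ.disintegrate σ.condKernel
  have e2 := (π₂ : Measure (E d × E d)).disintegrate (π₂ : Measure (E d × E d)).condKernel
  rw [hσ1] at e1
  rw [hπ1] at e2
  set κ := σ.condKernel
  set κ' := (π₂ : Measure (E d × E d)).condKernel
  -- The outer points are taken conditionally independent given the middle one. The coordinate order
  -- is middle, start, end.
  refine ⟨(ρ : Measure (E d)).compProd (κ.prod κ'), inferInstance, ?_, ?_⟩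
  · have h := Measure.compProd_map (μ := (ρ : Measure (E d))) (κ := κ.prod κ') measurable_fst
    rw [← ProbabilityTheory.Kernel.fst_eq, ProbabilityTheory.Kernel.fst_prod, e1] at h
    have h3 : (π₁ : Measure (E d × E d)) = σ.map Prod.swap := by
      rw [hσ, Measure.map_map measurable_swap measurable_swap, Prod.swap_swap_eq, Measure.map_id]
    rw [h3, h, Measure.map_map measurable_swap (by fun_prop)]
    rfl
  · have h := Measure.compProd_map (μ := (ρ : Measure (E d))) (κ := κ.prod κ') measurable_snd
    rw [← ProbabilityTheory.Kernel.snd_eq, ProbabilityTheory.Kernel.snd_prod, e2] at h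
    rw [h]
    rfl

/-- If `ρ` divides `μ` and `ν` in the ratio `t : 1 - t`, then up to a small error `ρ` is
the displacement interpolation along an almost optimal plan between `μ` and `ν`. -/
theorem exists_near_interpolation (hp : 1 < p) (hμ : μ ∈ probP d p) (hρ : ρ ∈ probP d p)
    (hν : ν ∈ probP d p) {t : ℝ} (ht0 : 0 < t) (ht1 : t < 1)
    (h₁ : W p μ ρ = t * W p μ ν) (h₂ : W p ρ ν = (1 - t) * W p μ ν) {η : ℝ} (hη : 0 < η) :
    ∃ Q : Measure (E d × E d × E d), IsProbabilityMeasure Q ∧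
      Q.map (fun z => z.1) = (ρ : Measure (E d)) ∧
      Q.map (fun z => z.2.1) = (μ : Measure (E d)) ∧
      Q.map (fun z => z.2.2) = (ν : Measure (E d)) ∧
      ∫ z, ‖z.2.1 - z.2.2‖ ^ p ∂Q ≤ W p μ ν ^ p + η ∧
      ∫ z, ‖z.1 - ((1 - t) • z.2.1 + t • z.2.2)‖ ^ p ∂Q ≤ η := by
  have hs : 0 < 1 - t := by linarith
  have hp1 : 1 ≤ p := hp.le
  have hp0 : 0 < p := by linarith
  set w := W p μ ν with hw
  have hw0 : 0 ≤ w := W_nonneg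
  have hwp : 0 ≤ w ^ p := by positivity
  -- Half of `η` pays for the `ε` term, since the moments of `u` and `v` below sum to at most `2 *
  -- (w ^ p + 1)`; the other half pays for `C * κ`.
  set ε := η / (4 * (w ^ p + 1)) with hε
  have hε0 : 0 < ε := by positivity
  obtain ⟨C, hC0, hC⟩ := exists_norm_sub_rpow_le (V := E d) hp ht0 ht1 hε0
  set κ := min 1 (min η (η / (2 * (C + 1)))) with hκ
  have hκ0 : 0 < κ := by positivity
  have hκ1 : κ ≤ 1 := min_le_left _ _
  have hκη : κ ≤ η := (min_le_right _ _).trans (min_le_left _ _)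
  have hκC : C * κ ≤ η / 2 := by
    have : κ ≤ η / (2 * (C + 1)) := (min_le_right _ _).trans (min_le_right _ _)
    rw [le_div_iff₀ (by positivity)] at this
    linarith
  -- The factors `t ^ p` and `(1 - t) ^ p` disappear when displacements are rescaled to velocities,
  -- leaving an excess `κ` for each.
  set δ₁ := κ * t ^ p with hδ₁
  set δ₂ := κ * (1 - t) ^ p with hδ₂
  obtain ⟨π₁, hπ₁, hi₁⟩ := exists_plan_integral_le hp1 hμ hρ (δ := δ₁) (by positivity)
  obtain ⟨π₂, hπ₂, hi₂⟩ := exists_plan_integral_le hp1 hρ hν (δ := δ₂) (by positivity)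
  obtain ⟨Q, hQ, hQ₁, hQ₂⟩ := exists_gluing hπ₁ hπ₂
  have m₁ : Measurable fun z : E d × E d × E d => (z.2.1, z.1) := by fun_prop
  have m₂ : Measurable fun z : E d × E d × E d => (z.1, z.2.2) := by fun_prop
  have q0 : Q.map (fun z => z.1) = (ρ : Measure (E d)) := by
    rw [← hπ₂.1, ← hQ₂, Measure.map_map measurable_fst m₂]
    rfl
  have q1 : Q.map (fun z => z.2.1) = (μ : Measure (E d)) := by
    rw [← hπ₁.1, ← hQ₁, Measure.map_map measurable_fst m₁]
    rfl
  have q2 : Q.map (fun z => z.2.2) = (ν : Measure (E d)) := by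
    rw [← hπ₂.2, ← hQ₂, Measure.map_map measurable_snd m₂]
    rfl
  have hcont : Continuous fun z : E d × E d => ‖z.1 - z.2‖ ^ p :=
    (continuous_fst.sub continuous_snd).norm.rpow_const fun _ => Or.inr hp0.le
  rw [← integral_comp_of_map_eq m₁ hQ₁ hcont, h₁, Real.mul_rpow ht0.le hw0] at hi₁
  rw [← integral_comp_of_map_eq m₂ hQ₂ hcont, h₂, Real.mul_rpow hs.le hw0] at hi₂
  have hZ := MemLp.comp_of_map_eq (by fun_prop) q0 ((mem_probP_iff_memLp hp1).1 hρ)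
  have hX := MemLp.comp_of_map_eq (by fun_prop) q1 ((mem_probP_iff_memLp hp1).1 hμ)
  have hY := MemLp.comp_of_map_eq (by fun_prop) q2 ((mem_probP_iff_memLp hp1).1 hν)
  -- `u` and `v` are the mean velocities on the two legs; their weighted mean is the whole
  -- displacement, and `t * (1 - t)` times their difference is the deviation from the interpolated
  -- point.
  set u : E d × E d × E d → E d := fun z => (-t⁻¹) • (z.2.1 - z.1) with hu
  set v : E d × E d × E d → E d := fun z => (-(1 - t)⁻¹) • (z.1 - z.2.2) with hv
  have hU : MemLp u (ENNReal.ofReal p) Q := (hX.sub hZ).const_smul (-t⁻¹)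
  have hV : MemLp v (ENNReal.ofReal p) Q := (hZ.sub hY).const_smul (-(1 - t)⁻¹)
  have hA : ∫ z, ‖u z‖ ^ p ∂Q ≤ w ^ p + κ := by
    have : ∀ z, ‖u z‖ ^ p = (t ^ p)⁻¹ * ‖z.2.1 - z.1‖ ^ p := fun z => by
      rw [hu, norm_smul, norm_neg, norm_inv, Real.norm_of_nonneg ht0.le,
        Real.mul_rpow (by positivity) (norm_nonneg _), Real.inv_rpow ht0.le]
    simp only [this]
    have htp : 0 < t ^ p := by positivity
    rw [integral_const_mul, inv_mul_le_iff₀ htp]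
    refine hi₁.trans_eq ?_
    rw [hδ₁]
    ring
  have hB : ∫ z, ‖v z‖ ^ p ∂Q ≤ w ^ p + κ := by
    have : ∀ z, ‖v z‖ ^ p = ((1 - t) ^ p)⁻¹ * ‖z.1 - z.2.2‖ ^ p := fun z => by
      rw [hv, norm_smul, norm_neg, norm_inv, Real.norm_of_nonneg hs.le,
        Real.mul_rpow (by positivity) (norm_nonneg _), Real.inv_rpow hs.le]
    simp only [this]
    have htp : 0 < (1 - t) ^ p := by positivity
    rw [integral_const_mul, inv_mul_le_iff₀ htp]
    refine hi₂.trans_eq ?_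
    rw [hδ₂]
    ring
  have iU := MemLp.integrable_rpow hp1 hU
  have iV := MemLp.integrable_rpow hp1 hV
  have iXY : Integrable (fun z : E d × E d × E d => ‖z.2.1 - z.2.2‖ ^ p) Q :=
    MemLp.integrable_rpow hp1 (hX.sub hY)
  have hUV : ∀ z, t • u z + (1 - t) • v z = -(z.2.1 - z.2.2) := fun z => by
    simp only [hu, hv, smul_smul, mul_neg, mul_inv_cancel₀ ht0.ne', mul_inv_cancel₀ hs.ne']
    module
  -- The outer coordinates form a plan between `μ` and `ν`, so the averaged velocity has moment at
  -- least `w ^ p`, while `u` and `v` have at most `w ^ p + κ`. The integrated convexity defect is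
  -- therefore at most `κ`.
  have hG : w ^ p ≤ ∫ z, ‖z.2.1 - z.2.2‖ ^ p ∂Q := by
    have m : Measurable fun z : E d × E d × E d => (z.2.1, z.2.2) := by fun_prop
    set π : ProbabilityMeasure (E d × E d) :=
      ⟨Q.map fun z => (z.2.1, z.2.2), Measure.isProbabilityMeasure_map m.aemeasurable⟩ with hπ
    have hmem : π ∈ plans μ ν := by
      constructor
      · rw [hπ, ProbabilityMeasure.coe_mk, Measure.map_map measurable_fst m]
        exact q1
      · rw [hπ, ProbabilityMeasure.coe_mk, Measure.map_map measurable_snd m]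
        exact q2
    have h := W_rpow_le hp1 hμ hν hmem
    rwa [← integral_comp_of_map_eq m (σ := (π : Measure (E d × E d))) rfl hcont] at h
  have hcomb : Integrable (fun z => t * ‖u z‖ ^ p + (1 - t) * ‖v z‖ ^ p) Q :=
    (iU.const_mul _).add (iV.const_mul _)
  have hcombI : ∫ z, (t * ‖u z‖ ^ p + (1 - t) * ‖v z‖ ^ p) ∂Q ≤ w ^ p + κ := by
    rw [integral_add (iU.const_mul _) (iV.const_mul _), integral_const_mul, integral_const_mul]
    linarith [mul_le_mul_of_nonneg_left hA ht0.le, mul_le_mul_of_nonneg_left hB hs.le]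
  refine ⟨Q, hQ, q0, q1, q2, ?_, ?_⟩
  · refine le_trans (integral_mono iXY hcomb fun z => ?_) (hcombI.trans (by linarith))
    have h := norm_combo_rpow_le hp ht0 ht1 (u z) (v z)
    rwa [hUV, norm_neg] at h
  · have hpt : ∀ z : E d × E d × E d, ‖z.1 - ((1 - t) • z.2.1 + t • z.2.2)‖ ^ p ≤
        ε * (‖u z‖ ^ p + ‖v z‖ ^ p) +
          C * (t * ‖u z‖ ^ p + (1 - t) * ‖v z‖ ^ p - ‖z.2.1 - z.2.2‖ ^ p) := fun z => by
      have h := hC (u z) (v z)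
      rw [hUV, norm_neg] at h
      refine le_trans (Real.rpow_le_rpow (norm_nonneg _) ?_ hp0.le) h
      have e : z.1 - ((1 - t) • z.2.1 + t • z.2.2) = (t * (1 - t)) • (u z - v z) := by
        have e1 : t * (1 - t) * t⁻¹ = 1 - t := by field_simp
        have e2 : t * (1 - t) * (1 - t)⁻¹ = t := by field_simp
        simp only [hu, hv, smul_sub (t * (1 - t)), smul_smul, mul_neg, e1, e2]
        module
      rw [e, norm_smul, Real.norm_of_nonneg (by positivity)]
      have : t * (1 - t) ≤ 1 := by nlinarith
      exact mul_le_of_le_one_left (norm_nonneg _) this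
    have hint1 : Integrable (fun z => ε * (‖u z‖ ^ p + ‖v z‖ ^ p)) Q := (iU.add iV).const_mul ε
    have hint2 : Integrable (fun z : E d × E d × E d =>
        C * (t * ‖u z‖ ^ p + (1 - t) * ‖v z‖ ^ p - ‖z.2.1 - z.2.2‖ ^ p)) Q :=
      (hcomb.sub iXY).const_mul C
    refine (integral_mono_of_nonneg (ae_of_all _ fun z => by positivity) (hint1.add hint2)
      (ae_of_all _ hpt)).trans ?_
    simp only [Pi.add_apply]
    rw [integral_add hint1 hint2, integral_const_mul, integral_const_mul, integral_add iU iV,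
      integral_sub hcomb iXY]
    have k1 := mul_le_mul_of_nonneg_left (add_le_add hA hB) hε0.le
    have k2 : ε * (w ^ p + κ + (w ^ p + κ)) ≤ η / 2 := by
      have : ε * (w ^ p + κ + (w ^ p + κ)) ≤ ε * (2 * (w ^ p + 1)) :=
        mul_le_mul_of_nonneg_left (by linarith) hε0.le
      refine this.trans_eq ?_
      rw [hε]
      field_simp
      ring
    have k3 := mul_le_mul_of_nonneg_left (sub_le_sub hcombI hG) hC0
    rw [add_sub_cancel_left] at k3
    linarith

/-! ### Semiconcavity along geodesics for `p > 1` -/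

theorem semiconcave_integral_infDist_rpow (hp : 1 < p) {S K : Set (E d)} {C : ℝ}
    (hC0 : 0 < C)
    (hC : ∀ x ∈ K, ∀ y ∈ K, ∀ t : ℝ, 0 ≤ t → t ≤ 1 →
      (1 - t) * Metric.infDist x S ^ p + t * Metric.infDist y S ^ p ≤
        Metric.infDist ((1 - t) • x + t • y) S ^ p + C * (t * (1 - t) * ‖x - y‖ ^ min p 2))
    (hμ : μ ∈ probPOn p K) (hρ : ρ ∈ probP d p) (hν : ν ∈ probPOn p K)
    {t : ℝ} (ht0 : 0 < t) (ht1 : t < 1)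
    (h₁ : W p μ ρ = t * W p μ ν) (h₂ : W p ρ ν = (1 - t) * W p μ ν) :
    (1 - t) * ∫ x, Metric.infDist x S ^ p ∂(μ : Measure (E d)) +
        t * ∫ x, Metric.infDist x S ^ p ∂(ν : Measure (E d)) ≤
      ∫ x, Metric.infDist x S ^ p ∂(ρ : Measure (E d)) +
        C * (t * (1 - t) * W p μ ν ^ min p 2) := by
  have hs : 0 < 1 - t := by linarith
  have hp1 : 1 ≤ p := hp.le
  have hp0 : 0 < p := by linarith
  set m := min p 2 with hm
  have hm1 : 1 ≤ m := le_min hp1 (by norm_num)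
  have hmp : m ≤ p := min_le_left _ _
  set w := W p μ ν with hw
  have hw0 : 0 ≤ w := W_nonneg
  set I := ∫ x, Metric.infDist x S ^ p ∂(ρ : Measure (E d)) with hI
  have hI0 : 0 ≤ I := integral_nonneg fun x => Real.rpow_nonneg Metric.infDist_nonneg _
  -- The pointwise inequality is integrated against the glued measure. Minkowski's inequality
  -- exchanges the interpolated point for the middle one at cost `η ^ (1 / p)`; monotonicity of
  -- `L^q` norms passes from exponent `p` to `m`.
  have key : ∀ η : ℝ, 0 < η →
      (1 - t) * ∫ x, Metric.infDist x S ^ p ∂(μ : Measure (E d)) +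
        t * ∫ x, Metric.infDist x S ^ p ∂(ν : Measure (E d)) ≤
      (I ^ (1 / p) + η ^ (1 / p)) ^ p + C * (t * (1 - t) * (w ^ p + η) ^ (m / p)) := by
    intro η hη
    obtain ⟨Q, hQ, q0, q1, q2, hxy, hz⟩ :=
      exists_near_interpolation hp hμ.1 hρ hν.1 ht0 ht1 h₁ h₂ hη
    have hZ := MemLp.comp_of_map_eq (by fun_prop) q0 ((mem_probP_iff_memLp hp1).1 hρ)
    have hX := MemLp.comp_of_map_eq (by fun_prop) q1 ((mem_probP_iff_memLp hp1).1 hμ.1)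
    have hY := MemLp.comp_of_map_eq (by fun_prop) q2 ((mem_probP_iff_memLp hp1).1 hν.1)
    have hDZ := MemLp.comp_of_map_eq (by fun_prop) q0 (memLp_infDist hp1 hρ S)
    have hcD := continuous_infDist_rpow hp1 S
    have iX : Integrable (fun z : E d × E d × E d => Metric.infDist z.2.1 S ^ p) Q := by
      have := integrable_infDist_rpow hp1 hμ.1 S
      rw [← q1] at this
      exact this.comp_measurable (by fun_prop)
    have iY : Integrable (fun z : E d × E d × E d => Metric.infDist z.2.2 S ^ p) Q := by
      have := integrable_infDist_rpow hp1 hν.1 S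
      rw [← q2] at this
      exact this.comp_measurable (by fun_prop)
    have hR : MemLp (fun z : E d × E d × E d => z.1 - ((1 - t) • z.2.1 + t • z.2.2))
        (ENNReal.ofReal p) Q := hZ.sub ((hX.const_smul (1 - t)).add (hY.const_smul t))
    have hle : ∀ z : E d × E d × E d, Metric.infDist ((1 - t) • z.2.1 + t • z.2.2) S ≤
        Metric.infDist z.1 S + ‖z.1 - ((1 - t) • z.2.1 + t • z.2.2)‖ := fun z => by
      rw [← dist_eq_norm, dist_comm]
      exact Metric.infDist_le_infDist_add_dist
    have iSum : Integrable (fun z : E d × E d × E d => (Metric.infDist z.1 S +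
        ‖z.1 - ((1 - t) • z.2.1 + t • z.2.2)‖) ^ p) Q := by
      have hsum : MemLp (fun z : E d × E d × E d => Metric.infDist z.1 S +
          ‖z.1 - ((1 - t) • z.2.1 + t • z.2.2)‖) (ENNReal.ofReal p) Q := hDZ.add hR.norm
      refine (MemLp.integrable_rpow hp1 hsum).congr (ae_of_all _ fun z => ?_)
      beta_reduce
      rw [Real.norm_of_nonneg (add_nonneg Metric.infDist_nonneg (norm_nonneg _))]
    have hlep : ∀ z : E d × E d × E d, Metric.infDist ((1 - t) • z.2.1 + t • z.2.2) S ^ p ≤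
        (Metric.infDist z.1 S + ‖z.1 - ((1 - t) • z.2.1 + t • z.2.2)‖) ^ p := fun z =>
      Real.rpow_le_rpow Metric.infDist_nonneg (hle z) hp0.le
    have hXY : MemLp (fun z : E d × E d × E d => z.2.1 - z.2.2) (ENNReal.ofReal p) Q := hX.sub hY
    have hm_int : Integrable (fun z : E d × E d × E d => ‖z.2.1 - z.2.2‖ ^ m) Q :=
      MemLp.integrable_rpow hm1 (hXY.mono_exponent (ENNReal.ofReal_le_ofReal hmp))
    have iC : Integrable (fun z : E d × E d × E d =>
        C * (t * (1 - t) * ‖z.2.1 - z.2.2‖ ^ m)) Q := (hm_int.const_mul (t * (1 - t))).const_mul C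
    have iXY : Integrable (fun z : E d × E d × E d => (1 - t) * Metric.infDist z.2.1 S ^ p +
        t * Metric.infDist z.2.2 S ^ p) Q := (iX.const_mul (1 - t)).add (iY.const_mul t)
    have step : ∫ z : E d × E d × E d, ((1 - t) * Metric.infDist z.2.1 S ^ p +
          t * Metric.infDist z.2.2 S ^ p) ∂Q ≤
        ∫ z : E d × E d × E d, ((Metric.infDist z.1 S +
          ‖z.1 - ((1 - t) • z.2.1 + t • z.2.2)‖) ^ p +
          C * (t * (1 - t) * ‖z.2.1 - z.2.2‖ ^ m)) ∂Q := by
      refine integral_mono_ae iXY (iSum.add iC) ?_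
      filter_upwards [ae_of_map_eq (by fun_prop) q1 (ae_mem_of_support_subset hμ.2),
        ae_of_map_eq (by fun_prop) q2 (ae_mem_of_support_subset hν.2)] with z hx hy
      exact (hC _ hx _ hy t ht0.le ht1.le).trans (add_le_add_left (hlep z) _)
    rw [integral_add (iX.const_mul _) (iY.const_mul _), integral_const_mul, integral_const_mul,
      integral_add iSum iC, integral_const_mul,
      integral_const_mul, integral_comp_of_map_eq (by fun_prop) q1 hcD,
      integral_comp_of_map_eq (by fun_prop) q2 hcD] at step
    refine step.trans (add_le_add ?_ ?_)
    · have h := integral_add_rpow_le hp1 (fun z => Metric.infDist_nonneg)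
        (fun z => norm_nonneg _) hDZ hR.norm
      have hη' := Real.rpow_le_rpow (integral_nonneg fun z => by positivity) hz
        (by positivity : 0 ≤ 1 / p)
      have h' := Real.rpow_le_rpow (Real.rpow_nonneg (integral_nonneg fun z =>
        Real.rpow_nonneg (add_nonneg Metric.infDist_nonneg (norm_nonneg _)) _) _)
        (h.trans (add_le_add_right hη' _)) hp0.le
      rwa [← Real.rpow_mul (integral_nonneg fun z =>
        Real.rpow_nonneg (add_nonneg Metric.infDist_nonneg (norm_nonneg _)) _),
        one_div_mul_cancel hp0.ne', Real.rpow_one,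
        integral_comp_of_map_eq (by fun_prop) q0 hcD] at h'
    · have h := integral_rpow_le_rpow_integral hm1 hmp hXY
      have h' := Real.rpow_le_rpow (integral_nonneg fun z => by positivity) hxy
        (by positivity : 0 ≤ m / p)
      gcongr
      exact h.trans h'
  have hpow : ∀ {q : ℝ}, 0 ≤ q → Continuous fun x : ℝ => x ^ q := fun hq =>
    Real.continuous_rpow_const hq
  have hcont : Continuous fun η : ℝ =>
      (I ^ (1 / p) + η ^ (1 / p)) ^ p + C * (t * (1 - t) * (w ^ p + η) ^ (m / p)) := by
    have c1 := hpow (by positivity : 0 ≤ 1 / p)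
    have c2 := (hpow hp0.le).comp (continuous_const.add c1 : Continuous fun η : ℝ =>
      I ^ (1 / p) + η ^ (1 / p))
    have c3 := (hpow (by positivity : 0 ≤ m / p)).comp (continuous_const.add continuous_id :
      Continuous fun η : ℝ => w ^ p + η)
    exact c2.add (continuous_const.mul (continuous_const.mul c3))
  -- The bound is continuous in `η`, also at `0`, where it becomes the claim.
  have hlim := (hcont.tendsto 0).mono_left (nhdsWithin_le_nhds (s := Ioi 0))
  have hfin := ge_of_tendsto hlim (Filter.eventually_of_mem self_mem_nhdsWithin key)
  rwa [Real.zero_rpow (by positivity), add_zero, add_zero, ← Real.rpow_mul hI0,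
    one_div_mul_cancel hp0.ne', Real.rpow_one, ← Real.rpow_mul hw0,
    mul_div_cancel₀ _ hp0.ne'] at hfin

/-! ### Lipschitz argument for `p = 1` -/

/-- The easy half of Kantorovich–Rubinstein duality, for the 1-Lipschitz function `Metric.infDist ·
S`. -/
theorem abs_integral_infDist_sub_le_W (hμ : μ ∈ probP d 1) (hν : ν ∈ probP d 1) (S : Set (E d)) :
    |∫ x, Metric.infDist x S ^ (1 : ℝ) ∂(μ : Measure (E d)) -
      ∫ x, Metric.infDist x S ^ (1 : ℝ) ∂(ν : Measure (E d))| ≤ W 1 μ ν := by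
  refine le_of_forall_pos_le_add fun δ hδ => ?_
  obtain ⟨π, hπ, h⟩ := exists_plan_integral_le le_rfl hμ hν hδ
  have hc := continuous_infDist_rpow le_rfl S
  have iX : Integrable (fun z : E d × E d => Metric.infDist z.1 S ^ (1 : ℝ))
      (π : Measure (E d × E d)) := by
    have := integrable_infDist_rpow le_rfl hμ S
    rw [← hπ.1] at this
    exact this.comp_measurable measurable_fst
  have iY : Integrable (fun z : E d × E d => Metric.infDist z.2 S ^ (1 : ℝ))
      (π : Measure (E d × E d)) := by
    have := integrable_infDist_rpow le_rfl hν S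
    rw [← hπ.2] at this
    exact this.comp_measurable measurable_snd
  rw [← integral_comp_of_map_eq measurable_fst hπ.1 hc,
    ← integral_comp_of_map_eq measurable_snd hπ.2 hc,
    ← integral_sub iX iY]
  rw [Real.rpow_one] at h
  refine le_trans ((abs_integral_le_integral_abs).trans (integral_mono_of_nonneg
    (ae_of_all _ fun z => abs_nonneg _) (MemLp.integrable_rpow le_rfl
      (memLp_sub_of_mem_plans le_rfl hμ hν hπ)) (ae_of_all _ fun z => ?_))) h
  simp only [Real.rpow_one]
  rw [abs_sub_le_iff, ← dist_eq_norm]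
  constructor
  · linarith [Metric.infDist_le_infDist_add_dist (s := S) (x := z.1) (y := z.2)]
  · linarith [Metric.infDist_le_infDist_add_dist (s := S) (x := z.2) (y := z.1),
      dist_comm z.1 z.2]

/-- The end points are at distances `t * W` and `(1 - t) * W` from `ρ` and carry weights `1 - t` and
`t`, so each contributes at most `t * (1 - t) * W`. -/
theorem semiconcave_integral_infDist {S : Set (E d)} (hμ : μ ∈ probP d 1) (hρ : ρ ∈ probP d 1)
    (hν : ν ∈ probP d 1) {t : ℝ} (ht0 : 0 ≤ t) (ht1 : t ≤ 1)
    (h₁ : W 1 μ ρ = t * W 1 μ ν) (h₂ : W 1 ρ ν = (1 - t) * W 1 μ ν) :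
    (1 - t) * ∫ x, Metric.infDist x S ^ (1 : ℝ) ∂(μ : Measure (E d)) +
        t * ∫ x, Metric.infDist x S ^ (1 : ℝ) ∂(ν : Measure (E d)) ≤
      ∫ x, Metric.infDist x S ^ (1 : ℝ) ∂(ρ : Measure (E d)) +
        2 * (t * (1 - t) * W 1 μ ν) := by
  have e1 := (abs_le.1 (abs_integral_infDist_sub_le_W hμ hρ S)).2
  have e2 := (abs_le.1 (abs_integral_infDist_sub_le_W hρ hν S)).1
  rw [h₁] at e1
  rw [h₂] at e2
  have hs : 0 ≤ 1 - t := by linarith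
  have k1 := mul_le_mul_of_nonneg_left e1 hs
  have k2 := mul_le_mul_of_nonneg_left e2 ht0
  linarith

end GenTarget

/-! ### Conclusion -/

theorem mainTheorem11 (d : ℕ) (p : ℝ) (hp : 1 ≤ p) (S K : Set (GenTarget.E d))
    (hKS : K ⊆ Sᶜ) (hKcompact : IsCompact K) (hKconvex : Convex ℝ K) :
    ∃ C : ℝ, 0 < C ∧
      ∀ Φ : Set (BoundedContinuousFunction (GenTarget.E d) ℝ),
        (GenTarget.targetP p Φ).Nonempty →
        GenTarget.IsClassicalCounterpart p (GenTarget.targetP p Φ) S →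
        ∀ μ : ℝ → ProbabilityMeasure (GenTarget.E d),
          μ 0 ∈ GenTarget.probPOn p K → μ 1 ∈ GenTarget.probPOn p K →
          GenTarget.IsGeodesic p μ →
          ∀ t ∈ Set.Icc (0 : ℝ) 1,
            GenTarget.genDist p (GenTarget.targetP p Φ) (μ t) ^ p ≥
              (1 - t) * GenTarget.genDist p (GenTarget.targetP p Φ) (μ 0) ^ p
                + t * GenTarget.genDist p (GenTarget.targetP p Φ) (μ 1) ^ p
                - C * t * (1 - t) * GenTarget.W p (μ 0) (μ 1) ^ min p 2 := by
  -- `C` is chosen before `Φ`. If `S` is empty or not closed, no `Φ` satisfies the hypotheses and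
  -- any constant will do.
  by_cases hS : IsClosed S ∧ S.Nonempty
  swap
  · exact ⟨1, one_pos, fun Φ hn hT => absurd ⟨hT.isClosed hp, hT.nonempty hn⟩ hS⟩
  obtain ⟨hSc, hSn⟩ := hS
  suffices h : ∃ C : ℝ, 0 < C ∧ ∀ μ : ℝ → ProbabilityMeasure (GenTarget.E d),
      μ 0 ∈ GenTarget.probPOn p K → μ 1 ∈ GenTarget.probPOn p K → GenTarget.IsGeodesic p μ →
      ∀ t : ℝ, 0 < t → t < 1 →
        (1 - t) * ∫ x, Metric.infDist x S ^ p ∂(μ 0 : Measure (GenTarget.E d)) +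
          t * ∫ x, Metric.infDist x S ^ p ∂(μ 1 : Measure (GenTarget.E d)) ≤
        ∫ x, Metric.infDist x S ^ p ∂(μ t : Measure (GenTarget.E d)) +
          C * (t * (1 - t) * GenTarget.W p (μ 0) (μ 1) ^ min p 2) by
    obtain ⟨C, hC0, hC⟩ := h
    refine ⟨C, hC0, fun Φ hn hT μ h0 h1 hg t ht => ?_⟩
    -- The end points are trivial and are split off because the velocities divide by `t` and `1 -
    -- t`.
    rcases ht.1.eq_or_lt with rfl | ht0
    · simp
    rcases ht.2.eq_or_lt with rfl | ht1
    · simp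
    rw [GenTarget.genDist_rpow hp (hg.mem t ht) hSc hSn hT,
      GenTarget.genDist_rpow hp h0.1 hSc hSn hT, GenTarget.genDist_rpow hp h1.1 hSc hSn hT]
    linarith [hC μ h0 h1 hg t ht0 ht1]
  rcases hp.eq_or_lt with rfl | hp1
  · refine ⟨2, two_pos, fun μ h0 h1 hg t ht0 ht1 => ?_⟩
    rw [min_eq_left (by norm_num : (1 : ℝ) ≤ 2), Real.rpow_one]
    refine GenTarget.semiconcave_integral_infDist h0.1 (hg.mem t ⟨ht0.le, ht1.le⟩) h1.1 ht0.le
      ht1.le ?_ (hg.speed t 1 ht0.le ht1.le le_rfl)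
    simpa using hg.speed 0 t le_rfl ht0.le ht1.le
  · obtain ⟨C, hC0, hC⟩ := GenTarget.exists_combo_infDist_rpow_le hp1 hSc hSn hKcompact hKconvex
    refine ⟨C, hC0, fun μ h0 h1 hg t ht0 ht1 => ?_⟩
    refine GenTarget.semiconcave_integral_infDist_rpow hp1 hC0 hC h0 (hg.mem t ⟨ht0.le, ht1.le⟩) h1
      ht0 ht1 ?_ (hg.speed t 1 ht0.le ht1.le le_rfl)
    simpa using hg.speed 0 t le_rfl ht0.le ht1.le
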